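/- Let $X=\{x_0,x_1,\dots,x_m\}$, let $X^*$ be the monoid of words over $X$, and let $\mathbb{R}^m\langle\langle X\rangle\rangle$ be the set of all formal power series $c=\sum_{\eta\in X^*}(c,\eta)\,\eta$ with coefficients $(c,\eta)\in\mathbb{R}^m$ and components $c_1,\dots,c_m$ (no convergence is required). Let $\sqcup\!\sqcup$ denote the shuffle product. For $d\in\mathbb{R}^m\langle\langle X\rangle\rangle$ set $d_0:=0$, $\phi_d(x_i)(e)=x_ie+x_0(d_i \sqcup\!\sqcup e)$ for $e\in\mathbb{R}\langle\langle X\rangle\rangle$, $\phi_d(\emptyset)=\mathrm{id}$, $\phi_d(x_i\eta)=\phi_d(x_i)\circ\phi_d(\eta)$, and $$c\,\tilde\circ\, d=\sum_{\eta\in X^*}(c,\eta)\,\phi_d(\eta)(1),\qquad c\circledcirc d=d+c\,\tilde\circ\, d .$$ The set of formal symbols $c_\delta=\delta+c$, $c\in\mathbb{R}^m\langle\langle X\rangle\rangle$, is a group under $(\delta+c)\circ(\delta+d)=\delta+c\circledcirc d$ with identity $\delta$; write $(\delta+c)^{-1}=\delta+c^{-1}$. Let $H$ be the free unital commutative $\mathbb{R}$-algebra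 on the symbols $a^i_\eta$ ($1\le i\le m$, $\eta\in X^*$). Elements of $H$ are regarded as functions on $\mathbb{R}^m\langle\langle X\rangle\rangle$ through $a^i_\eta(c)=(c_i,\eta)$, and elements of $H\otimes H$ as functions of two series through $(p\otimes q)(c,d)=p(c)q(d)$. Then there is exactly one Hopf algebra structure on the algebra $H$ whose coproduct $\Delta$ and counit $\varepsilon$ are algebra homomorphisms with $$\Delta a^i_\eta(c,d)=a^i_\eta(c\circledcirc d)\ \text{ for all series } c,d,\qquad \varepsilon(a^i_\eta)=0,$$ for all $i$ and $\eta$. Its antipode $S$ satisfies $$a^i_\eta(c^{-1})=(S a^i_\eta)(c)\qquad\text{for all } 1\le i\le m,\ \eta\in X^*,\ c\in\mathbb{R}^m\langle\langle X\rangle\rangle .$$ -/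

import Mathlib

open scoped TensorProduct

noncomputable section

namespace OutputFeedback

/-- Words over the alphabet `X = {x_0, x_1, ..., x_m}`; the letter `x_i` is `i : Fin (m + 1)`
and the empty word is `[]`. -/
abbrev Word (m : ℕ) : Type := List (Fin (m + 1))

/-- Real-valued formal power series over `X`: the value at a word is its coefficient. -/
abbrev ScalarSeries (m : ℕ) : Type := Word m → ℝ

/-- Formal power series over `X` with coefficients in `ℝ^m`, given by their `m` components. The
component written `c_i` on paper, `1 ≤ i ≤ m`, has index `i - 1 : Fin m`. -/
abbrev Series (m : ℕ) : Type := Fin m → ScalarSeries m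

/-- The shuffle product of two words, as a finite multiset of words. -/
def shuffleWord {m : ℕ} : Word m → Word m → Multiset (Word m)
  | [], ξ => {ξ}
  | i :: η, [] => {i :: η}
  | i :: η, j :: ξ =>
      (shuffleWord η (j :: ξ)).map (fun w => i :: w) +
        (shuffleWord (i :: η) ξ).map (fun w => j :: w)
  termination_by η ξ => η.length + ξ.length

/-- The shuffle product of two series: the coefficient of `ζ` is the sum over all pairs of words
`(η, ξ)` of `(c, η) (d, ξ) (η ⧢ ξ, ζ)`; only finitely many terms are nonzero, see
`finite_support_shuffle`. -/
def shuffle {m : ℕ} (c d : ScalarSeries m) : ScalarSeries m := fun ζ =>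
  ∑ᶠ p : Word m × Word m, c p.1 * d p.2 * ((shuffleWord p.1 p.2).count ζ : ℝ)

/-- Left catenation `e ↦ x_i e` by a letter. -/
def leftMul {m : ℕ} (i : Fin (m + 1)) (e : ScalarSeries m) : ScalarSeries m
  | [] => 0
  | j :: η => if j = i then e η else 0

/-- The series `1 = 1∅`. -/
def unitSeries (m : ℕ) : ScalarSeries m := fun η => if η = [] then 1 else 0

/-- The components of `d` indexed by the letters, with the convention `d_0 = 0`. -/
def component {m : ℕ} (d : Series m) : Fin (m + 1) → ScalarSeries m := Fin.cons 0 d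

/-- `φ_d(x_i)(e) = x_i e + x_0 (d_i ⧢ e)`. -/
def phiLetter {m : ℕ} (d : Series m) (i : Fin (m + 1)) (e : ScalarSeries m) : ScalarSeries m :=
  leftMul i e + leftMul 0 (shuffle (component d i) e)

/-- `φ_d` on words: `φ_d(∅) = id` and `φ_d(x_i η) = φ_d(x_i) ∘ φ_d(η)`. -/
def phi {m : ℕ} (d : Series m) : Word m → ScalarSeries m → ScalarSeries m
  | [] => id
  | i :: η => phiLetter d i ∘ phi d η

/-- The modified composition product `∑_η (c, η) φ_d(η)(1)`, componentwise in `c`. Only finitely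
many terms contribute to each coefficient, see `finite_support_modComp`. -/
def modComp {m : ℕ} (c d : Series m) : Series m := fun i ζ =>
  ∑ᶠ η : Word m, c i η * phi d η (unitSeries m) ζ

/-- The product `c ⊚ d = d + c ∘̃ d` on series, so that `(δ + c) ∘ (δ + d) = δ + c ⊚ d`. -/
def groupProd {m : ℕ} (c d : Series m) : Series m := d + modComp c d

/-- The set of series `c_δ = δ + c`; the element `δ + c` is `⟨c⟩`. -/
@[ext]
structure DeltaSeries (m : ℕ) : Type where
  /-- The series `c` in `δ + c`. -/
  toSeries : Series m

/-- The series `δ = δ + 0`. -/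
def DeltaSeries.delta (m : ℕ) : DeltaSeries m := ⟨0⟩

/-- The composition `(δ + c) ∘ (δ + d) = δ + c ⊚ d`. -/
def DeltaSeries.comp {m : ℕ} (c d : DeltaSeries m) : DeltaSeries m :=
  ⟨groupProd c.toSeries d.toSeries⟩

/-- The free unital commutative `ℝ`-algebra `H` on the symbols `a^i_η`. -/
abbrev CoordAlgebra (m : ℕ) : Type := MvPolynomial (Fin m × Word m) ℝ

/-- The generator `a^i_η` of `H`. -/
def coord {m : ℕ} (i : Fin m) (η : Word m) : CoordAlgebra m := MvPolynomial.X (i, η)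

/-- Elements of `H` as functions on series: the value `p(c)`, determined by
`a^i_η(c) = (c_i, η)`, together with multiplicativity and linearity. -/
def evalAt {m : ℕ} (c : Series m) : CoordAlgebra m →ₐ[ℝ] ℝ :=
  MvPolynomial.aeval (fun p : Fin m × Word m => c p.1 p.2)

/-- Elements of `H ⊗ H` as functions of two series: `(p ⊗ q)(c, d) = p(c) q(d)`. -/
def evalPair {m : ℕ} (c d : Series m) : CoordAlgebra m ⊗[ℝ] CoordAlgebra m →ₐ[ℝ] ℝ :=
  Algebra.TensorProduct.lift (evalAt c) (evalAt d) (fun _ _ => Commute.all _ _)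

/-- The counit of `H`: `ε(a^i_η) = 0` and `ε(1) = 1`. -/
def counitHom (m : ℕ) : CoordAlgebra m →ₐ[ℝ] ℝ :=
  MvPolynomial.aeval (fun _ : Fin m × Word m => (0 : ℝ))

/-- The property defining the coproduct: `Δ a^i_η (c, d) = a^i_η (c ⊚ d)`. -/
def IsCoproduct {m : ℕ} (Δ : CoordAlgebra m →ₐ[ℝ] CoordAlgebra m ⊗[ℝ] CoordAlgebra m) : Prop :=
  ∀ (i : Fin m) (η : Word m) (c d : Series m),
    evalPair c d (Δ (coord i η)) = evalAt (groupProd c d) (coord i η)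

/-- `h` is a Hopf algebra structure on `H` whose underlying bialgebra consists of the polynomial
algebra `H`, a coproduct `Δ` with `Δ a^i_η (c, d) = a^i_η (c ⊚ d)`, and the counit `ε`. -/
def IsOutputFeedbackHopf {m : ℕ} (h : HopfAlgebra ℝ (CoordAlgebra m)) : Prop :=
  ∃ (Δ : CoordAlgebra m →ₐ[ℝ] CoordAlgebra m ⊗[ℝ] CoordAlgebra m)
    (h_coassoc : (Algebra.TensorProduct.assoc ℝ ℝ ℝ (CoordAlgebra m) (CoordAlgebra m)
        (CoordAlgebra m)).toAlgHom.comp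
          ((Algebra.TensorProduct.map Δ (AlgHom.id ℝ (CoordAlgebra m))).comp Δ) =
      (Algebra.TensorProduct.map (AlgHom.id ℝ (CoordAlgebra m)) Δ).comp Δ)
    (h_left : (Algebra.TensorProduct.map (counitHom m) (AlgHom.id ℝ (CoordAlgebra m))).comp Δ =
      (Algebra.TensorProduct.lid ℝ (CoordAlgebra m)).symm)
    (h_right : (Algebra.TensorProduct.map (AlgHom.id ℝ (CoordAlgebra m)) (counitHom m)).comp Δ =
      (Algebra.TensorProduct.rid ℝ ℝ (CoordAlgebra m)).symm),
    IsCoproduct Δ ∧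
      h.toBialgebra = Bialgebra.ofAlgHom Δ (counitHom m) h_coassoc h_left h_right

/-! The sums in `shuffle` and `modComp` are finite. -/

theorem length_of_mem_shuffleWord {m : ℕ} (η ξ : Word m) :
    ∀ ζ ∈ shuffleWord η ξ, ζ.length = η.length + ξ.length := by
  fun_induction shuffleWord η ξ with
  | case1 ξ => simp
  | case2 i η => simp
  | case3 i η j ξ ih1 ih2 =>
    intro ζ hζ
    simp only [Multiset.mem_add, Multiset.mem_map] at hζ
    rcases hζ with ⟨w, hw, rfl⟩ | ⟨w, hw, rfl⟩
    · have := ih1 w hw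
      simp only [List.length_cons] at this ⊢
      omega
    · have := ih2 w hw
      simp only [List.length_cons] at this ⊢
      omega

theorem finite_words_le (m n : ℕ) : {η : Word m | η.length ≤ n}.Finite :=
  List.finite_length_le (Fin (m + 1)) n

theorem finite_support_shuffle {m : ℕ} (c d : ScalarSeries m) (ζ : Word m) :
    (Function.support fun p : Word m × Word m =>
      c p.1 * d p.2 * ((shuffleWord p.1 p.2).count ζ : ℝ)).Finite := by
  refine ((finite_words_le m ζ.length).prod (finite_words_le m ζ.length)).subset ?_
  intro p hp
  have h0 : (shuffleWord p.1 p.2).count ζ ≠ 0 := by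
    intro h
    simp [h] at hp
  have := length_of_mem_shuffleWord p.1 p.2 ζ (Multiset.count_ne_zero.mp h0)
  simp only [Set.mem_prod, Set.mem_ofPred_eq]
  omega

theorem shuffle_eq_zero {m : ℕ} (c e : ScalarSeries m) (n : ℕ)
    (he : ∀ ζ : Word m, ζ.length < n → e ζ = 0) (ζ : Word m) (hζ : ζ.length < n) :
    shuffle c e ζ = 0 := by
  refine finsum_eq_zero_of_forall_eq_zero fun p => ?_
  by_cases h0 : (shuffleWord p.1 p.2).count ζ = 0
  · simp [h0]
  · have := length_of_mem_shuffleWord p.1 p.2 ζ (Multiset.count_ne_zero.mp h0)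
    rw [he p.2 (by omega)]
    simp

theorem phi_eq_zero {m : ℕ} (d : Series m) (η : Word m) :
    ∀ ζ : Word m, ζ.length < η.length → phi d η (unitSeries m) ζ = 0 := by
  induction η with
  | nil => intro ζ hζ; simp at hζ
  | cons i η ih =>
    intro ζ hζ
    cases ζ with
    | nil => simp [phi, phiLetter, leftMul]
    | cons j ζ =>
      have hl : ζ.length < η.length := by simpa using hζ
      have h1 := ih ζ hl
      have h2 := shuffle_eq_zero (component d i) _ η.length ih ζ hl
      simp [phi, phiLetter, leftMul, h1, h2]

theorem finite_support_modComp {m : ℕ} (c d : Series m) (i : Fin m) (ζ : Word m) :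
    (Function.support fun η : Word m => c i η * phi d η (unitSeries m) ζ).Finite := by
  refine (finite_words_le m ζ.length).subset ?_
  intro η hη
  by_contra h
  have h' : ζ.length < η.length := by simpa using h
  simp [phi_eq_zero d η ζ h'] at hη

end OutputFeedback

end

noncomputable section

namespace OutputFeedback

/-! Elements of `H` are the polynomial functions on the group of series, so each Hopf axiom is a
group axiom read through evaluation.

On the group side, a series is determined by its constant term and its left derivatives. Each
`x_j⁻¹` is a derivation of ⧢ (`shuffle_cons`), and `leftDeriv_scalarComp` gives the matching
recursion for `∘̃`. Induction on word length then shows that `· ∘̃ d` respects ⧢ and that `(c ∘̃ d)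
∘̃ e = c ∘̃ (d ⊚ e)`, hence associativity. The same recursion can be solved for the left factor,
which gives left inverses.

On the algebra side, coefficients of `c ⊚ d` and `c⁻¹` are polynomials in those of `c` and `d`,
which produces `Δ` and `S`. Points separate elements of `H`, `H ⊗ H` and `H ⊗ (H ⊗ H)`, so the
axioms and the uniqueness of `Δ` are checked pointwise. The antipode is unique as a convolution
inverse. -/

/-! ### Left derivatives and the algebra of the shuffle product -/

/-- The left derivative `c ↦ x_j⁻¹ c` of a series by a letter. -/
def leftDeriv {m : ℕ} (j : Fin (m + 1)) : ScalarSeries m →ₗ[ℝ] ScalarSeries m :=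
  LinearMap.funLeft ℝ ℝ (fun η : Word m => j :: η)

@[simp] theorem leftDeriv_apply {m : ℕ} (j : Fin (m + 1)) (c : ScalarSeries m) (η : Word m) :
    leftDeriv j c η = c (j :: η) := rfl

theorem count_nil_shuffleWord {m : ℕ} (η ξ : Word m) :
    (shuffleWord η ξ).count [] = if η = [] ∧ ξ = [] then 1 else 0 := by
  split_ifs with h
  · obtain ⟨rfl, rfl⟩ := h
    simp [shuffleWord]
  · rw [Multiset.count_eq_zero]
    intro hmem
    have := length_of_mem_shuffleWord η ξ _ hmem
    simp only [List.length_nil] at this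
    exact h ⟨List.length_eq_zero_iff.mp (by omega), List.length_eq_zero_iff.mp (by omega)⟩

theorem shuffleWord_nil_right {m : ℕ} (η : Word m) : shuffleWord η [] = {η} := by
  cases η <;> simp [shuffleWord]

theorem count_map_cons {m : ℕ} (i j : Fin (m + 1)) (s : Multiset (Word m)) (ζ : Word m) :
    (s.map fun w => i :: w).count (j :: ζ) = if i = j then s.count ζ else 0 := by
  split_ifs with h
  · subst h
    exact Multiset.count_map_eq_count' _ _ List.cons_injective _
  · rw [Multiset.count_eq_zero]
    simp [h]

/-- The function on words equal to `f η` at `x_j η`, and zero at words not starting with `x_j`. -/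
def ifCons {m : ℕ} (j : Fin (m + 1)) (f : Word m → ℕ) : Word m → ℕ
  | [] => 0
  | i :: η => if i = j then f η else 0

/-- The first letter of a shuffle comes from one of the two words; `ifCons` makes this uniform,
empty words included. -/
theorem count_cons_shuffleWord {m : ℕ} (j : Fin (m + 1)) (ζ η ξ : Word m) :
    (shuffleWord η ξ).count (j :: ζ) =
      ifCons j (fun η' => (shuffleWord η' ξ).count ζ) η +
        ifCons j (fun ξ' => (shuffleWord η ξ').count ζ) ξ := by
  rcases η with _ | ⟨i, η⟩ <;> rcases ξ with _ | ⟨k, ξ⟩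
  · simp [shuffleWord, ifCons]
  · simp only [shuffleWord, ifCons, Multiset.count_singleton, List.cons.injEq, zero_add]
    split_ifs <;> simp_all
  · simp only [shuffleWord_nil_right, ifCons, Multiset.count_singleton,
      List.cons.injEq, add_zero]
    split_ifs <;> simp_all
  · simp only [shuffleWord, ifCons, Multiset.count_add, count_map_cons]

theorem finsum_range_eq {α β M : Type*} [AddCommMonoid M] (g : α → β)
    (hg : Function.Injective g) (f : β → M) (h : ∀ b, b ∉ Set.range g → f b = 0) :
    ∑ᶠ b, f b = ∑ᶠ a, f (g a) := by
  rw [← finsum_mem_range hg, finsum_mem_def]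
  refine finsum_congr fun b => ?_
  by_cases hb : b ∈ Set.range g
  · rw [Set.indicator_of_mem hb]
  · rw [Set.indicator_of_notMem hb, h b hb]

theorem shuffle_nil {m : ℕ} (c d : ScalarSeries m) : shuffle c d [] = c [] * d [] := by
  unfold shuffle
  rw [finsum_eq_single _ (([], []) : Word m × Word m)]
  · simp [count_nil_shuffleWord]
  · intro p hp
    have : ¬ (p.1 = [] ∧ p.2 = []) := fun h => hp (Prod.ext h.1 h.2)
    simp [count_nil_shuffleWord, this]

/-- Together with `shuffle_nil` this replaces the count of word shuffles: commutativity, bilinearity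
and associativity follow by induction on the word. -/
theorem shuffle_cons {m : ℕ} (c d : ScalarSeries m) (j : Fin (m + 1)) (ζ : Word m) :
    shuffle c d (j :: ζ) = shuffle (leftDeriv j c) d ζ + shuffle c (leftDeriv j d) ζ := by
  have hfin : ∀ f : Word m × Word m → ℝ,
      (∀ p, (shuffleWord p.1 p.2).count (j :: ζ) = 0 → f p = 0) →
        (Function.support f).Finite := by
    intro f hf
    refine (finite_support_shuffle (fun _ => 1) (fun _ => 1) (j :: ζ)).subset fun p hp => ?_
    have : (shuffleWord p.1 p.2).count (j :: ζ) ≠ 0 := fun h => hp (hf p h)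
    simpa using this
  unfold shuffle
  simp only [count_cons_shuffleWord, Nat.cast_add, mul_add]
  rw [finsum_add_distrib]
  · congr 1
    · rw [finsum_range_eq (fun p : Word m × Word m => (j :: p.1, p.2))]
      · simp [ifCons]
      · rintro ⟨a, b⟩ ⟨a', b'⟩ h
        simpa using h
      · rintro ⟨_ | ⟨i, η⟩, ξ⟩ h
        · simp [ifCons]
        · have : i ≠ j := by
            rintro rfl
            exact h ⟨(η, ξ), rfl⟩
          simp [ifCons, this]
    · rw [finsum_range_eq (fun p : Word m × Word m => (p.1, j :: p.2))]
      · simp [ifCons]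
      · rintro ⟨a, b⟩ ⟨a', b'⟩ h
        simpa using h
      · rintro ⟨ξ, _ | ⟨i, η⟩⟩ h
        · simp [ifCons]
        · have : i ≠ j := by
            rintro rfl
            exact h ⟨(ξ, η), rfl⟩
          simp [ifCons, this]
  · refine hfin _ fun p hp => ?_
    rw [count_cons_shuffleWord, Nat.add_eq_zero_iff] at hp
    simp [hp.1]
  · refine hfin _ fun p hp => ?_
    rw [count_cons_shuffleWord, Nat.add_eq_zero_iff] at hp
    simp [hp.2]

theorem shuffle_comm {m : ℕ} (c d : ScalarSeries m) : shuffle c d = shuffle d c := by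
  funext ζ
  induction ζ generalizing c d with
  | nil => rw [shuffle_nil, shuffle_nil, mul_comm]
  | cons j ζ ih => rw [shuffle_cons, shuffle_cons, ih, ih c, add_comm]

theorem shuffle_add_right {m : ℕ} (c d e : ScalarSeries m) :
    shuffle c (d + e) = shuffle c d + shuffle c e := by
  funext ζ
  induction ζ generalizing c d e with
  | nil => simp [shuffle_nil, mul_add]
  | cons j ζ ih =>
    simp only [shuffle_cons, map_add, ih, Pi.add_apply]
    ring

theorem shuffle_smul_right {m : ℕ} (r : ℝ) (c d : ScalarSeries m) :
    shuffle c (r • d) = r • shuffle c d := by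
  funext ζ
  induction ζ generalizing c d with
  | nil => simp [shuffle_nil, mul_left_comm]
  | cons j ζ ih => simp [shuffle_cons, ih, mul_add]

/-- The shuffle product as a bilinear map. -/
def shuffleHom (m : ℕ) : ScalarSeries m →ₗ[ℝ] ScalarSeries m →ₗ[ℝ] ScalarSeries m :=
  LinearMap.mk₂ ℝ shuffle
    (fun c c' d => by simp only [shuffle_comm _ d, shuffle_add_right])
    (fun r c d => by simp only [shuffle_comm _ d, shuffle_smul_right])
    shuffle_add_right
    (fun r c d => shuffle_smul_right r c d)

theorem shuffle_add_left {m : ℕ} (c d e : ScalarSeries m) :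
    shuffle (c + d) e = shuffle c e + shuffle d e :=
  (shuffleHom m).map_add₂ c d e

theorem shuffle_zero_left {m : ℕ} (c : ScalarSeries m) : shuffle 0 c = 0 :=
  (shuffleHom m).map_zero₂ c

theorem shuffle_sum_left {m : ℕ} {ι : Type*} (s : Finset ι) (f : ι → ScalarSeries m)
    (c : ScalarSeries m) : shuffle (∑ i ∈ s, f i) c = ∑ i ∈ s, shuffle (f i) c :=
  LinearMap.map_sum₂ (shuffleHom m) s f c

theorem shuffle_sum_right {m : ℕ} {ι : Type*} (s : Finset ι) (f : ι → ScalarSeries m)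
    (c : ScalarSeries m) : shuffle c (∑ i ∈ s, f i) = ∑ i ∈ s, shuffle c (f i) :=
  map_sum (shuffleHom m c) f s

theorem leftDeriv_shuffle {m : ℕ} (j : Fin (m + 1)) (c d : ScalarSeries m) :
    leftDeriv j (shuffle c d) = shuffle (leftDeriv j c) d + shuffle c (leftDeriv j d) :=
  funext fun ζ => shuffle_cons c d j ζ

theorem shuffle_assoc {m : ℕ} (c d e : ScalarSeries m) :
    shuffle (shuffle c d) e = shuffle c (shuffle d e) := by
  funext ζ
  induction ζ generalizing c d e with
  | nil => simp only [shuffle_nil, mul_assoc]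
  | cons j ζ ih =>
    simp only [shuffle_cons, leftDeriv_shuffle, shuffle_add_left, shuffle_add_right, ih,
      Pi.add_apply]
    ring

theorem shuffle_left_comm {m : ℕ} (c d e : ScalarSeries m) :
    shuffle c (shuffle d e) = shuffle d (shuffle c e) := by
  rw [← shuffle_assoc, shuffle_comm c d, shuffle_assoc]

/-- Shuffling never shortens words. This carries an induction hypothesis on short words inside a
shuffle. -/
theorem shuffle_congr_right {m : ℕ} (c : ScalarSeries m) {e e' : ScalarSeries m} {n : ℕ}
    (h : ∀ ζ : Word m, ζ.length ≤ n → e ζ = e' ζ) {ζ : Word m} (hζ : ζ.length ≤ n) :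
    shuffle c e ζ = shuffle c e' ζ := by
  have h0 : shuffle c (e - e') ζ = 0 :=
    shuffle_eq_zero c (e - e') (n + 1) (fun ξ hξ => sub_eq_zero.mpr (h ξ (by omega))) ζ (by omega)
  have h1 : shuffle c (e - e') = shuffle c e - shuffle c e' := map_sub (shuffleHom m c) e e'
  rw [h1, Pi.sub_apply, sub_eq_zero] at h0
  exact h0

/-! ### The modified composition product and its recursion -/

/-- The modified composition product of a scalar series with a series. -/
def scalarComp {m : ℕ} (c : ScalarSeries m) (d : Series m) : ScalarSeries m := fun ζ =>
  ∑ᶠ η : Word m, c η * phi d η (unitSeries m) ζ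

/-- The words of length at most `n`. -/
def wordsLE (m n : ℕ) : Finset (Word m) := (finite_words_le m n).toFinset

@[simp] theorem mem_wordsLE {m n : ℕ} {η : Word m} : η ∈ wordsLE m n ↔ η.length ≤ n := by
  simp [wordsLE]

/-- The bound `n` is free so that one finite sum serves all words up to that length at once. -/
theorem scalarComp_eq_sum {m : ℕ} (c : ScalarSeries m) (d : Series m) {n : ℕ} {ζ : Word m}
    (hζ : ζ.length ≤ n) :
    scalarComp c d ζ = ∑ η ∈ wordsLE m n, c η * phi d η (unitSeries m) ζ := by
  refine finsum_eq_sum_of_support_subset _ fun η hη => ?_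
  by_contra h
  have h' : n < η.length := by simpa using h
  simp [phi_eq_zero d η ζ (by omega)] at hη

theorem scalarComp_add {m : ℕ} (c c' : ScalarSeries m) (d : Series m) :
    scalarComp (c + c') d = scalarComp c d + scalarComp c' d := by
  funext ζ
  simp only [scalarComp_eq_sum _ _ le_rfl, Pi.add_apply, add_mul, Finset.sum_add_distrib]

theorem scalarComp_smul {m : ℕ} (r : ℝ) (c : ScalarSeries m) (d : Series m) :
    scalarComp (r • c) d = r • scalarComp c d := by
  funext ζ
  simp only [scalarComp_eq_sum _ _ le_rfl, Pi.smul_apply, smul_eq_mul, mul_assoc, Finset.mul_sum]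

/-- The modified composition product is linear in its left argument. -/
def scalarCompHom {m : ℕ} (d : Series m) : ScalarSeries m →ₗ[ℝ] ScalarSeries m where
  toFun c := scalarComp c d
  map_add' c c' := scalarComp_add c c' d
  map_smul' r c := scalarComp_smul r c d

theorem scalarComp_zero {m : ℕ} (d : Series m) : scalarComp 0 d = 0 :=
  map_zero (scalarCompHom d)

theorem scalarComp_sum {m : ℕ} {ι : Type*} (s : Finset ι) (f : ι → ScalarSeries m)
    (d : Series m) : scalarComp (∑ i ∈ s, f i) d = ∑ i ∈ s, scalarComp (f i) d :=
  map_sum (scalarCompHom d) f s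

theorem scalarComp_nil {m : ℕ} (c : ScalarSeries m) (d : Series m) :
    scalarComp c d [] = c [] := by
  unfold scalarComp
  rw [finsum_eq_single _ ([] : Word m)]
  · simp [phi, unitSeries]
  · intro η hη
    rw [phi_eq_zero d η [] (List.length_pos_iff.mpr hη), mul_zero]

theorem phi_cons_apply_cons {m : ℕ} (d : Series m) (i j : Fin (m + 1)) (η ζ : Word m) :
    phi d (i :: η) (unitSeries m) (j :: ζ) =
      (if j = i then phi d η (unitSeries m) ζ else 0) +
        if j = 0 then shuffle (component d i) (phi d η (unitSeries m)) ζ else 0 := rfl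

theorem sum_wordsLE_succ {m : ℕ} (n : ℕ) (f : Word m → ℝ) (h0 : f [] = 0) :
    ∑ η ∈ wordsLE m (n + 1), f η = ∑ i, ∑ η ∈ wordsLE m n, f (i :: η) := by
  rw [← Finset.sum_product', ← Finset.sum_erase (wordsLE m (n + 1)) h0]
  symm
  refine Finset.sum_bij (fun p _ => p.1 :: p.2) ?_ ?_ ?_ ?_
  · rintro ⟨i, η⟩ h
    simpa using h
  · rintro ⟨i, η⟩ _ ⟨i', η'⟩ _ h
    simpa using h
  · rintro (_ | ⟨i, η⟩) h
    · simp at h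
    · exact ⟨(i, η), by simpa using h, rfl⟩
  · intros
    rfl

/-- Up to length `n` the composition is a finite combination of series, through which the shuffle
passes by linearity. -/
theorem sum_mul_shuffle_phi {m : ℕ} (b c : ScalarSeries m) (d : Series m) {n : ℕ} {ζ : Word m}
    (hζ : ζ.length ≤ n) :
    ∑ η ∈ wordsLE m n, c η * shuffle b (phi d η (unitSeries m)) ζ =
      shuffle b (scalarComp c d) ζ := by
  have h : shuffle b (scalarComp c d) ζ =
      shuffle b (∑ η ∈ wordsLE m n, c η • phi d η (unitSeries m)) ζ := by
    refine shuffle_congr_right b (fun ξ hξ => ?_) hζ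
    rw [scalarComp_eq_sum c d hξ]
    simp
  rw [h, shuffle_sum_right]
  simp [shuffle_smul_right]

/-- Sort the words `η` by first letter: `x_i e` in `φ_d(x_i)(e)` gives the first term, `x_0 (d_i ⧢
e)` the correction at `j = 0`. As `d_0 = 0`, only the letters `x_1, ..., x_m` contribute to the
correction. -/
theorem leftDeriv_scalarComp {m : ℕ} (c : ScalarSeries m) (d : Series m) (j : Fin (m + 1)) :
    leftDeriv j (scalarComp c d) = scalarComp (leftDeriv j c) d +
      if j = 0 then ∑ i : Fin m, shuffle (d i) (scalarComp (leftDeriv i.succ c) d) else 0 := by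
  funext ζ
  rw [leftDeriv_apply, scalarComp_eq_sum c d (le_refl (j :: ζ).length), List.length_cons,
    sum_wordsLE_succ _ _ (by simp [phi, unitSeries])]
  simp only [phi_cons_apply_cons, mul_add, Finset.sum_add_distrib, Pi.add_apply]
  congr 1
  · rw [Finset.sum_eq_single j]
    · rw [scalarComp_eq_sum _ _ le_rfl]
      simp
    · intro i _ hi
      simp [Ne.symm hi]
    · simp
  · split_ifs with hj
    · rw [Fin.sum_univ_succ]
      have h0 : component d 0 = 0 := rfl
      have hs : ∀ i : Fin m, component d i.succ = d i := fun i => rfl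
      simp only [h0, hs, shuffle_zero_left, Pi.zero_apply, mul_zero, Finset.sum_const_zero,
        zero_add, Finset.sum_apply]
      refine Finset.sum_congr rfl fun i _ => ?_
      rw [← sum_mul_shuffle_phi _ _ _ le_rfl]
      rfl
    · simp

theorem scalarComp_shuffle {m : ℕ} (c e : ScalarSeries m) (d : Series m) :
    scalarComp (shuffle c e) d = shuffle (scalarComp c d) (scalarComp e d) := by
  -- The hypothesis is needed inside a shuffle, hence at all words of length at most `n`, not only
  -- at the tail `ζ`.
  suffices h : ∀ (n : ℕ) (c e : ScalarSeries m) (ζ : Word m), ζ.length ≤ n →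
      scalarComp (shuffle c e) d ζ = shuffle (scalarComp c d) (scalarComp e d) ζ from
    funext fun ζ => h _ c e ζ le_rfl
  intro n
  induction n with
  | zero =>
    intro c e ζ hζ
    obtain rfl := List.length_eq_zero_iff.mp (Nat.le_zero.mp hζ)
    simp only [scalarComp_nil, shuffle_nil]
  | succ n ih =>
    rintro c e (_ | ⟨j, ζ⟩) hζ
    · simp only [scalarComp_nil, shuffle_nil]
    · have hζ' : ζ.length ≤ n := by simpa using hζ
      have ih' : ∀ (b c e : ScalarSeries m), shuffle b (scalarComp (shuffle c e) d) ζ =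
          shuffle b (shuffle (scalarComp c d) (scalarComp e d)) ζ := fun b c e =>
        shuffle_congr_right b (fun ξ hξ => ih c e ξ hξ) hζ'
      rw [← leftDeriv_apply j (scalarComp (shuffle c e) d),
        ← leftDeriv_apply j (shuffle (scalarComp c d) (scalarComp e d))]
      rw [leftDeriv_shuffle]
      simp only [leftDeriv_scalarComp, leftDeriv_shuffle, scalarComp_add]
      split_ifs with hj
      · simp only [shuffle_add_left, shuffle_add_right, Pi.add_apply, Finset.sum_apply,
          shuffle_sum_left, shuffle_sum_right, ih _ _ ζ hζ', ih', shuffle_assoc,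
          Finset.sum_add_distrib, shuffle_left_comm (scalarComp c d)]
        ring
      · simp only [add_zero, Pi.add_apply, Pi.zero_apply, ih _ _ ζ hζ']

/-! ### The group of series -/

theorem groupProd_apply {m : ℕ} (c d : Series m) (i : Fin m) :
    groupProd c d i = d i + scalarComp (c i) d := rfl

/-- At `x_0` the left side acquires corrections with factors `e_i` (outer composition) and `d_i ∘̃
e` (inner one, by `scalarComp_shuffle`). Their sum is `(d ⊚ e)_i`, the factor on the right. -/
theorem scalarComp_scalarComp {m : ℕ} (c : ScalarSeries m) (d e : Series m) :
    scalarComp (scalarComp c d) e = scalarComp c (groupProd d e) := by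
  suffices h : ∀ (n : ℕ) (c : ScalarSeries m) (ζ : Word m), ζ.length ≤ n →
      scalarComp (scalarComp c d) e ζ = scalarComp c (groupProd d e) ζ from
    funext fun ζ => h _ c ζ le_rfl
  intro n
  induction n with
  | zero =>
    intro c ζ hζ
    obtain rfl := List.length_eq_zero_iff.mp (Nat.le_zero.mp hζ)
    simp only [scalarComp_nil]
  | succ n ih =>
    rintro c (_ | ⟨j, ζ⟩) hζ
    · simp only [scalarComp_nil]
    · have hζ' : ζ.length ≤ n := by simpa using hζ
      have ih' : ∀ b c : ScalarSeries m, shuffle b (scalarComp (scalarComp c d) e) ζ =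
          shuffle b (scalarComp c (groupProd d e)) ζ := fun b c =>
        shuffle_congr_right b (fun ξ hξ => ih c ξ hξ) hζ'
      rw [← leftDeriv_apply j (scalarComp (scalarComp c d) e),
        ← leftDeriv_apply j (scalarComp c (groupProd d e))]
      simp only [leftDeriv_scalarComp, scalarComp_add]
      split_ifs with hj
      · have hs : ∀ i : Fin m, i.succ ≠ 0 := Fin.succ_ne_zero
        simp only [hs, if_false, scalarComp_zero, add_zero, scalarComp_sum, scalarComp_shuffle, Pi.add_apply,
          Finset.sum_apply, ih _ ζ hζ', ih', groupProd_apply, shuffle_add_left,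
          Finset.sum_add_distrib]
        ring
      · simp only [add_zero, scalarComp_zero, ih _ ζ hζ']

theorem groupProd_assoc {m : ℕ} (c d e : Series m) :
    groupProd (groupProd c d) e = groupProd c (groupProd d e) := by
  funext i
  simp only [groupProd_apply, scalarComp_add, scalarComp_scalarComp, add_assoc]

theorem zero_groupProd {m : ℕ} (d : Series m) : groupProd 0 d = d := by
  funext i
  simp [groupProd_apply, scalarComp_zero]

/-- One step of the recursion for `invComp`. -/
def invStep {m : ℕ} (c : Series m) (j : Fin (m + 1)) (y : ScalarSeries m) : ScalarSeries m :=
  leftDeriv j y - if j = 0 then ∑ i : Fin m, shuffle (c i) (leftDeriv i.succ y) else 0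

/-- The solution `x` of `x ∘̃ c = y`. -/
def invComp {m : ℕ} (c : Series m) (y : ScalarSeries m) : ScalarSeries m
  | [] => y []
  | j :: ζ => invComp c (invStep c j y) ζ

theorem leftDeriv_invComp {m : ℕ} (c : Series m) (j : Fin (m + 1)) (y : ScalarSeries m) :
    leftDeriv j (invComp c y) = invComp c (invStep c j y) := rfl

/-- The recursion is triangular: the correction at `x_0` involves only derivatives by `x_1, ...,
x_m`, which have no correction themselves. Subtracting it in `invStep` therefore cancels it exactly.
-/
theorem scalarComp_invComp {m : ℕ} (c : Series m) (y : ScalarSeries m) :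
    scalarComp (invComp c y) c = y := by
  suffices h : ∀ (n : ℕ) (y : ScalarSeries m) (ζ : Word m), ζ.length ≤ n →
      scalarComp (invComp c y) c ζ = y ζ from
    funext fun ζ => h _ y ζ le_rfl
  intro n
  induction n with
  | zero =>
    intro y ζ hζ
    obtain rfl := List.length_eq_zero_iff.mp (Nat.le_zero.mp hζ)
    rw [scalarComp_nil, invComp]
  | succ n ih =>
    rintro y (_ | ⟨j, ζ⟩) hζ
    · rw [scalarComp_nil, invComp]
    · have hζ' : ζ.length ≤ n := by simpa using hζ
      have ih' : ∀ b y : ScalarSeries m, shuffle b (scalarComp (invComp c y) c) ζ =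
          shuffle b y ζ := fun b y => shuffle_congr_right b (fun ξ hξ => ih y ξ hξ) hζ'
      rw [← leftDeriv_apply j (scalarComp (invComp c y) c)]
      rw [leftDeriv_scalarComp]
      simp only [leftDeriv_invComp, Pi.add_apply, ih _ ζ hζ']
      have hs : ∀ i : Fin m, i.succ ≠ 0 := Fin.succ_ne_zero
      split_ifs with hj
      · simp only [invStep, hj, hs, Finset.sum_apply, ih', if_true, if_false, sub_zero,
          Pi.sub_apply, leftDeriv_apply]
        ring
      · simp [invStep, hj]

/-- The inverse of a series for `groupProd`. -/
def groupInv {m : ℕ} (c : Series m) : Series m := fun i => invComp c (-(c i))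

theorem groupInv_groupProd {m : ℕ} (c : Series m) : groupProd (groupInv c) c = 0 := by
  funext i
  simp [groupProd_apply, groupInv, scalarComp_invComp]

/-- The group structure on the series `δ + c`. -/
@[reducible] def deltaGroup (m : ℕ) : Group (DeltaSeries m) :=
  letI : Mul (DeltaSeries m) := ⟨DeltaSeries.comp⟩
  letI : Inv (DeltaSeries m) := ⟨fun c => ⟨groupInv c.toSeries⟩⟩
  letI : One (DeltaSeries m) := ⟨DeltaSeries.delta m⟩
  Group.ofLeftAxioms
    (fun c d e => DeltaSeries.ext (groupProd_assoc c.toSeries d.toSeries e.toSeries))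
    (fun c => DeltaSeries.ext (zero_groupProd c.toSeries))
    (fun c => DeltaSeries.ext (groupInv_groupProd c.toSeries))

/-- The right-hand laws come for free from the left group axioms. -/
theorem groupProd_groupInv {m : ℕ} (c : Series m) : groupProd c (groupInv c) = 0 :=
  congrArg DeltaSeries.toSeries
    (@mul_inv_cancel (DeltaSeries m) (deltaGroup m) ⟨c⟩)

theorem groupProd_zero {m : ℕ} (c : Series m) : groupProd c 0 = c :=
  congrArg DeltaSeries.toSeries
    (@mul_one (DeltaSeries m) (deltaGroup m).toMulOneClass ⟨c⟩)

/-! ### Polynomial dependence of coefficients -/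

/-- `P` stands for the polynomial functions on a parameter space `V`: later, one series for the
antipode and a pair for the coproduct. -/
theorem polynomial_shuffle {m : ℕ} {V : Type*} (P : Subalgebra ℝ (V → ℝ))
    {f g : V → ScalarSeries m} (hf : ∀ ζ, (fun v => f v ζ) ∈ P) (hg : ∀ ζ, (fun v => g v ζ) ∈ P)
    (ζ : Word m) : (fun v => shuffle (f v) (g v) ζ) ∈ P := by
  induction ζ generalizing f g with
  | nil =>
    simp only [shuffle_nil]
    exact P.mul_mem (hf _) (hg _)
  | cons j ζ ih =>
    simp only [shuffle_cons]
    exact P.add_mem (ih (fun ξ => hf (j :: ξ)) hg) (ih hf fun ξ => hg (j :: ξ))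

theorem polynomial_phi {m : ℕ} {V : Type*} (P : Subalgebra ℝ (V → ℝ))
    {d : V → Series m} (hd : ∀ i ζ, (fun v => d v i ζ) ∈ P) (η ζ : Word m) :
    (fun v => phi (d v) η (unitSeries m) ζ) ∈ P := by
  induction η generalizing ζ with
  | nil =>
    simp only [phi, id]
    exact P.algebraMap_mem _
  | cons i η ih =>
    cases ζ with
    | nil =>
      simp only [phi_eq_zero _ (i :: η) [] (by simp)]
      exact P.zero_mem
    | cons j ζ =>
      simp only [phi_cons_apply_cons]
      refine P.add_mem ?_ ?_
      · split_ifs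
        · exact ih ζ
        · exact P.zero_mem
      · split_ifs
        · refine polynomial_shuffle P (fun ξ => ?_) ih ζ
          refine Fin.cases ?_ (fun k => ?_) i
          · exact P.zero_mem
          · exact hd k ξ
        · exact P.zero_mem

theorem polynomial_groupProd {m : ℕ} {V : Type*} (P : Subalgebra ℝ (V → ℝ))
    {c d : V → Series m} (hc : ∀ i ζ, (fun v => c v i ζ) ∈ P)
    (hd : ∀ i ζ, (fun v => d v i ζ) ∈ P) (i : Fin m) (ζ : Word m) :
    (fun v => groupProd (c v) (d v) i ζ) ∈ P := by
  simp only [groupProd_apply, Pi.add_apply, scalarComp_eq_sum _ _ (le_refl ζ.length)]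
  refine P.add_mem (hd i ζ) ?_
  have := P.sum_mem fun η (_ : η ∈ wordsLE m ζ.length) =>
    P.mul_mem (hc i η) (polynomial_phi P hd η ζ)
  convert this using 1
  funext v
  simp

theorem polynomial_groupInv {m : ℕ} {V : Type*} (P : Subalgebra ℝ (V → ℝ))
    {c : V → Series m} (hc : ∀ i ζ, (fun v => c v i ζ) ∈ P) (i : Fin m) (ζ : Word m) :
    (fun v => groupInv (c v) i ζ) ∈ P := by
  -- `invComp` replaces `y` at every letter, so `y` must be arbitrary.
  suffices h : ∀ (ζ : Word m) (y : V → ScalarSeries m), (∀ ξ, (fun v => y v ξ) ∈ P) →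
      (fun v => invComp (c v) (y v) ζ) ∈ P from h ζ _ fun ξ => P.neg_mem (hc i ξ)
  intro ζ
  induction ζ with
  | nil => exact fun y hy => hy []
  | cons j ζ ih =>
    intro y hy
    refine ih (fun v => invStep (c v) j (y v)) fun ξ => ?_
    refine P.sub_mem (hy (j :: ξ)) ?_
    split_ifs
    · have := P.sum_mem fun i (_ : i ∈ Finset.univ) =>
        polynomial_shuffle P (hc i) (fun ζ => hy (i.succ :: ζ)) ξ
      convert this using 1
      funext v
      simp only [Finset.sum_apply]
      rfl
    · exact P.zero_mem

/-! ### Separation of tensors by points -/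

/-- Expand `t` along a basis of `B`. Applying `χ a` to the coefficients gives an element of `B`
killed by every `ψ b`, hence zero; independence makes every `χ a` kill each coefficient. Arbitrary
families allow iteration to triple tensors. -/
theorem tensor_eq_zero_of_lift_eq_zero {K A B α β : Type*} [Field K] [CommRing A] [CommRing B]
    [Algebra K A] [Algebra K B] (χ : α → A →ₐ[K] K) (ψ : β → B →ₐ[K] K)
    (hχ : ∀ x, (∀ a, χ a x = 0) → x = 0) (hψ : ∀ x, (∀ b, ψ b x = 0) → x = 0)
    (t : A ⊗[K] B)
    (ht : ∀ a b, Algebra.TensorProduct.lift (χ a) (ψ b) (fun _ _ => Commute.all _ _) t = 0) :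
    t = 0 := by
  classical
  let 𝒞 := Module.Basis.ofVectorSpace K B
  obtain ⟨f, rfl⟩ := (TensorProduct.equivFinsuppOfBasisRight (M := A) 𝒞).symm.surjective t
  suffices hf : f = 0 by rw [hf, map_zero]
  ext k
  refine hχ _ fun a => ?_
  have h0 : ∑ i ∈ f.support, χ a (f i) • 𝒞 i = 0 := by
    refine hψ _ fun b => ?_
    have := ht a b
    rw [TensorProduct.equivFinsuppOfBasisRight_symm_apply, Finsupp.sum, map_sum] at this
    simpa using this
  by_cases hk : k ∈ f.support
  · exact linearIndependent_iff'.mp 𝒞.linearIndependent _ _ h0 k hk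
  · rw [Finsupp.notMem_support_iff.mp hk, map_zero]

/-- Without a convergence condition every point of affine space is a series, and a real polynomial
vanishing everywhere is zero. -/
theorem coordAlgebra_eq_zero {m : ℕ} (p : CoordAlgebra m) (h : ∀ c : Series m, evalAt c p = 0) :
    p = 0 := by
  refine MvPolynomial.funext fun x => ?_
  rw [map_zero]
  exact h fun i η => x (i, η)

theorem coordAlgebra_ext {m : ℕ} {p q : CoordAlgebra m}
    (h : ∀ c : Series m, evalAt c p = evalAt c q) : p = q :=
  sub_eq_zero.mp (coordAlgebra_eq_zero _ fun c => by rw [map_sub, h, sub_self])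

theorem tensor_eq_zero {m : ℕ} (t : CoordAlgebra m ⊗[ℝ] CoordAlgebra m)
    (h : ∀ p : Series m × Series m, evalPair p.1 p.2 t = 0) : t = 0 :=
  tensor_eq_zero_of_lift_eq_zero evalAt evalAt coordAlgebra_eq_zero coordAlgebra_eq_zero t
    fun a b => h (a, b)

theorem tensor_ext {m : ℕ} {s t : CoordAlgebra m ⊗[ℝ] CoordAlgebra m}
    (h : ∀ c d : Series m, evalPair c d s = evalPair c d t) : s = t :=
  sub_eq_zero.mp (tensor_eq_zero _ fun p => by rw [map_sub, h, sub_self])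

/-- Elements of `H ⊗ (H ⊗ H)` as functions of three series. -/
def evalTriple {m : ℕ} (c d e : Series m) :
    CoordAlgebra m ⊗[ℝ] (CoordAlgebra m ⊗[ℝ] CoordAlgebra m) →ₐ[ℝ] ℝ :=
  Algebra.TensorProduct.lift (evalAt c) (evalPair d e) (fun _ _ => Commute.all _ _)

@[simp] theorem evalPair_tmul {m : ℕ} (c d : Series m) (p q : CoordAlgebra m) :
    evalPair c d (p ⊗ₜ q) = evalAt c p * evalAt d q :=
  Algebra.TensorProduct.lift_tmul _ _ _ _ _

@[simp] theorem evalTriple_tmul {m : ℕ} (c d e : Series m) (p : CoordAlgebra m)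
    (t : CoordAlgebra m ⊗[ℝ] CoordAlgebra m) :
    evalTriple c d e (p ⊗ₜ t) = evalAt c p * evalPair d e t :=
  Algebra.TensorProduct.lift_tmul _ _ _ _ _

theorem tensor_triple_ext {m : ℕ}
    {s t : CoordAlgebra m ⊗[ℝ] (CoordAlgebra m ⊗[ℝ] CoordAlgebra m)}
    (h : ∀ c d e : Series m, evalTriple c d e s = evalTriple c d e t) : s = t := by
  refine sub_eq_zero.mp (tensor_eq_zero_of_lift_eq_zero evalAt
    (fun p : Series m × Series m => evalPair p.1 p.2) coordAlgebra_eq_zero tensor_eq_zero _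
    fun c p => ?_)
  rw [map_sub]
  exact sub_eq_zero.mpr (h c p.1 p.2)

/-! ### Coproduct and antipode on generators -/

theorem exists_coproduct {m : ℕ} (i : Fin m) (η : Word m) :
    ∃ t : CoordAlgebra m ⊗[ℝ] CoordAlgebra m,
      ∀ c d : Series m, evalPair c d t = groupProd c d i η := by
  let ev := AlgHom.pi (fun v : Series m × Series m => evalPair v.1 v.2)
  obtain ⟨t, ht⟩ : (fun v : Series m × Series m => groupProd v.1 v.2 i η) ∈ ev.range := by
    refine polynomial_groupProd ev.range (fun i ζ => ⟨coord i ζ ⊗ₜ 1, ?_⟩)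
      (fun i ζ => ⟨1 ⊗ₜ coord i ζ, ?_⟩) i η
    · funext v
      simp [ev, evalPair, evalAt, coord]
    · funext v
      simp [ev, evalPair, evalAt, coord]
  exact ⟨t, fun c d => congrFun ht (c, d)⟩

theorem exists_antipode {m : ℕ} (i : Fin m) (η : Word m) :
    ∃ p : CoordAlgebra m, ∀ c : Series m, evalAt c p = groupInv c i η := by
  let ev := AlgHom.pi (fun c : Series m => evalAt c)
  obtain ⟨p, hp⟩ : (fun c : Series m => groupInv c i η) ∈ ev.range := by
    refine polynomial_groupInv ev.range (fun i ζ => ⟨coord i ζ, ?_⟩) i η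
    funext v
    simp [ev, evalAt, coord]
  exact ⟨p, fun c => congrFun hp c⟩

/-- The coproduct of `H`. -/
def coproduct (m : ℕ) : CoordAlgebra m →ₐ[ℝ] CoordAlgebra m ⊗[ℝ] CoordAlgebra m :=
  MvPolynomial.aeval fun p => (exists_coproduct p.1 p.2).choose

/-- The antipode of `H`. -/
def antipodeHom (m : ℕ) : CoordAlgebra m →ₐ[ℝ] CoordAlgebra m :=
  MvPolynomial.aeval fun p => (exists_antipode p.1 p.2).choose

theorem isCoproduct_coproduct (m : ℕ) : IsCoproduct (coproduct m) := fun i η c d => by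
  simpa [coproduct, coord, evalAt] using (exists_coproduct i η).choose_spec c d

theorem evalPair_comp {m : ℕ} {Δ : CoordAlgebra m →ₐ[ℝ] CoordAlgebra m ⊗[ℝ] CoordAlgebra m}
    (hΔ : IsCoproduct Δ) (c d : Series m) :
    (evalPair c d).comp Δ = evalAt (groupProd c d) :=
  MvPolynomial.algHom_ext fun p => hΔ p.1 p.2 c d

theorem evalPair_apply {m : ℕ} {Δ : CoordAlgebra m →ₐ[ℝ] CoordAlgebra m ⊗[ℝ] CoordAlgebra m}
    (hΔ : IsCoproduct Δ) (c d : Series m) (p : CoordAlgebra m) :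
    evalPair c d (Δ p) = evalAt (groupProd c d) p :=
  DFunLike.congr_fun (evalPair_comp hΔ c d) p

theorem evalAt_antipodeHom {m : ℕ} (c : Series m) (p : CoordAlgebra m) :
    evalAt c (antipodeHom m p) = evalAt (groupInv c) p := by
  have h : (evalAt c).comp (antipodeHom m) = evalAt (groupInv c) :=
    MvPolynomial.algHom_ext fun p => by
      simpa [antipodeHom, evalAt] using (exists_antipode p.1 p.2).choose_spec c
  exact DFunLike.congr_fun h p

theorem isCoproduct_unique {m : ℕ}
    {Δ Δ' : CoordAlgebra m →ₐ[ℝ] CoordAlgebra m ⊗[ℝ] CoordAlgebra m}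
    (h : IsCoproduct Δ) (h' : IsCoproduct Δ') : Δ = Δ' :=
  AlgHom.ext fun p => tensor_ext fun c d => by rw [evalPair_apply h, evalPair_apply h']

/-- The counit is evaluation at the group identity, so the counit axioms become the unit laws. -/
theorem counitHom_eq_evalAt (m : ℕ) : counitHom m = evalAt 0 := rfl

/-! ### Hopf algebra axioms -/

theorem coproduct_coassoc (m : ℕ) :
    (Algebra.TensorProduct.assoc ℝ ℝ ℝ (CoordAlgebra m) (CoordAlgebra m)
        (CoordAlgebra m)).toAlgHom.comp
          ((Algebra.TensorProduct.map (coproduct m) (AlgHom.id ℝ (CoordAlgebra m))).comp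
            (coproduct m)) =
      (Algebra.TensorProduct.map (AlgHom.id ℝ (CoordAlgebra m)) (coproduct m)).comp
        (coproduct m) := by
  refine AlgHom.ext fun p => tensor_triple_ext fun c d e => ?_
  -- At `(c, d, e)` the two sides become `p((c ⊚ d) ⊚ e)` and `p(c ⊚ (d ⊚ e))`.
  have hassoc : (evalTriple c d e).comp (Algebra.TensorProduct.assoc ℝ ℝ ℝ (CoordAlgebra m)
      (CoordAlgebra m) (CoordAlgebra m)).toAlgHom =
      Algebra.TensorProduct.lift (evalPair c d) (evalAt e) (fun _ _ => Commute.all _ _) := by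
    ext <;> simp [Algebra.TensorProduct.one_def]
  have h1 : ((evalTriple c d e).comp (Algebra.TensorProduct.assoc ℝ ℝ ℝ (CoordAlgebra m)
      (CoordAlgebra m) (CoordAlgebra m)).toAlgHom).comp
      (Algebra.TensorProduct.map (coproduct m) (AlgHom.id ℝ (CoordAlgebra m))) =
      evalPair (groupProd c d) e := by
    rw [hassoc]
    refine Algebra.TensorProduct.ext' fun p q => ?_
    simp [evalPair_apply (isCoproduct_coproduct m)]
  have h2 : (evalTriple c d e).comp
      (Algebra.TensorProduct.map (AlgHom.id ℝ (CoordAlgebra m)) (coproduct m)) =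
      evalPair c (groupProd d e) := by
    refine Algebra.TensorProduct.ext' fun p q => ?_
    simp [evalPair_apply (isCoproduct_coproduct m)]
  have h3 := DFunLike.congr_fun h1 (coproduct m p)
  have h4 := DFunLike.congr_fun h2 (coproduct m p)
  rw [evalPair_apply (isCoproduct_coproduct m)] at h3 h4
  rw [groupProd_assoc, ← h4] at h3
  exact h3

theorem coproduct_left (m : ℕ) :
    (Algebra.TensorProduct.map (counitHom m) (AlgHom.id ℝ (CoordAlgebra m))).comp (coproduct m) =
      (Algebra.TensorProduct.lid ℝ (CoordAlgebra m)).symm := by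
  refine AlgHom.ext fun p => (Algebra.TensorProduct.lid ℝ (CoordAlgebra m)).injective ?_
  refine coordAlgebra_ext fun c => ?_
  have h : ((evalAt c).comp (Algebra.TensorProduct.lid ℝ (CoordAlgebra m)).toAlgHom).comp
      (Algebra.TensorProduct.map (counitHom m) (AlgHom.id ℝ (CoordAlgebra m))) =
      evalPair 0 c := by
    rw [counitHom_eq_evalAt]
    refine Algebra.TensorProduct.ext' fun p q => ?_
    simp [mul_comm]
  have h' := DFunLike.congr_fun h (coproduct m p)
  rw [evalPair_apply (isCoproduct_coproduct m), zero_groupProd] at h'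
  refine h'.trans ?_
  simp

theorem coproduct_right (m : ℕ) :
    (Algebra.TensorProduct.map (AlgHom.id ℝ (CoordAlgebra m)) (counitHom m)).comp (coproduct m) =
      (Algebra.TensorProduct.rid ℝ ℝ (CoordAlgebra m)).symm := by
  refine AlgHom.ext fun p => (Algebra.TensorProduct.rid ℝ ℝ (CoordAlgebra m)).injective ?_
  refine coordAlgebra_ext fun c => ?_
  have h : ((evalAt c).comp (Algebra.TensorProduct.rid ℝ ℝ (CoordAlgebra m)).toAlgHom).comp
      (Algebra.TensorProduct.map (AlgHom.id ℝ (CoordAlgebra m)) (counitHom m)) =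
      evalPair c 0 := by
    rw [counitHom_eq_evalAt]
    refine Algebra.TensorProduct.ext' fun p q => ?_
    simp [mul_comm]
  have h' := DFunLike.congr_fun h (coproduct m p)
  rw [evalPair_apply (isCoproduct_coproduct m), groupProd_zero] at h'
  refine h'.trans ?_
  simp

/-- The bialgebra structure on `H`. -/
@[reducible] def coordBialgebra (m : ℕ) : Bialgebra ℝ (CoordAlgebra m) :=
  Bialgebra.ofAlgHom (coproduct m) (counitHom m) (coproduct_coassoc m) (coproduct_left m)
    (coproduct_right m)

/-- At a point `c` this reads `p(c⁻¹ ⊚ c) = p(0)`. -/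
theorem antipodeHom_left (m : ℕ) :
    (Algebra.TensorProduct.lift (antipodeHom m) (AlgHom.id ℝ (CoordAlgebra m))
      fun _ _ => Commute.all _ _).comp (coproduct m) =
      (Algebra.ofId ℝ (CoordAlgebra m)).comp (counitHom m) := by
  refine AlgHom.ext fun p => coordAlgebra_ext fun c => ?_
  have h : (evalAt c).comp (Algebra.TensorProduct.lift (antipodeHom m)
      (AlgHom.id ℝ (CoordAlgebra m)) fun _ _ => Commute.all _ _) = evalPair (groupInv c) c := by
    refine Algebra.TensorProduct.ext' fun p q => ?_
    simp [evalAt_antipodeHom]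
  have h' := DFunLike.congr_fun h (coproduct m p)
  rw [evalPair_apply (isCoproduct_coproduct m), groupInv_groupProd] at h'
  refine h'.trans ?_
  simp [counitHom_eq_evalAt, Algebra.ofId_apply]

theorem antipodeHom_right (m : ℕ) :
    (Algebra.TensorProduct.lift (AlgHom.id ℝ (CoordAlgebra m)) (antipodeHom m)
      fun _ _ => Commute.all _ _).comp (coproduct m) =
      (Algebra.ofId ℝ (CoordAlgebra m)).comp (counitHom m) := by
  refine AlgHom.ext fun p => coordAlgebra_ext fun c => ?_
  have h : (evalAt c).comp (Algebra.TensorProduct.lift (AlgHom.id ℝ (CoordAlgebra m))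
      (antipodeHom m) fun _ _ => Commute.all _ _) = evalPair c (groupInv c) := by
    refine Algebra.TensorProduct.ext' fun p q => ?_
    simp [evalAt_antipodeHom]
  have h' := DFunLike.congr_fun h (coproduct m p)
  rw [evalPair_apply (isCoproduct_coproduct m), groupProd_groupInv] at h'
  refine h'.trans ?_
  simp [counitHom_eq_evalAt, Algebra.ofId_apply]

/-- The Hopf algebra structure on `H`. -/
@[reducible] def coordHopfAlgebra (m : ℕ) : HopfAlgebra ℝ (CoordAlgebra m) :=
  letI := coordBialgebra m
  HopfAlgebra.ofAlgHom (antipodeHom m) (antipodeHom_left m) (antipodeHom_right m)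

theorem isOutputFeedbackHopf_coordHopfAlgebra (m : ℕ) :
    IsOutputFeedbackHopf (coordHopfAlgebra m) :=
  ⟨coproduct m, coproduct_coassoc m, coproduct_left m, coproduct_right m,
    isCoproduct_coproduct m, rfl⟩

/-! ### Uniqueness -/

/-- An antipode is a two-sided inverse of the identity in the convolution monoid, which the
bialgebra already determines. -/
theorem hopfAlgebra_ext {R A : Type*} [CommSemiring R] [Semiring A] {h h' : HopfAlgebra R A}
    (hb : h.toBialgebra = h'.toBialgebra) : h = h' := by
  rcases h with @⟨⟨S⟩, hl, hr⟩
  rcases h' with @⟨⟨S'⟩, hl', hr'⟩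
  subst hb
  have : WithConv.toConv S = WithConv.toConv S' :=
    left_inv_eq_right_inv (a := WithConv.toConv LinearMap.id)
      (WithConv.ext hl) (WithConv.ext hr')
  obtain rfl := WithConv.toConv_injective this
  rfl

theorem isOutputFeedbackHopf_unique {m : ℕ} {h h' : HopfAlgebra ℝ (CoordAlgebra m)}
    (hh : IsOutputFeedbackHopf h) (hh' : IsOutputFeedbackHopf h') : h = h' := by
  obtain ⟨Δ, _, _, _, hΔ, hb⟩ := hh
  obtain ⟨Δ', _, _, _, hΔ', hb'⟩ := hh'
  obtain rfl := isCoproduct_unique hΔ hΔ'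
  exact hopfAlgebra_ext (hb.trans hb'.symm)

end OutputFeedback

end

theorem mainTheorem6 (m : ℕ) :
    ∃ G : Group (OutputFeedback.DeltaSeries m),
      (∀ c d : OutputFeedback.DeltaSeries m, c * d = c.comp d) ∧
      (1 : OutputFeedback.DeltaSeries m) = OutputFeedback.DeltaSeries.delta m ∧
      (∃! h : HopfAlgebra ℝ (OutputFeedback.CoordAlgebra m),
        OutputFeedback.IsOutputFeedbackHopf h) ∧
      ∀ h : HopfAlgebra ℝ (OutputFeedback.CoordAlgebra m),
        OutputFeedback.IsOutputFeedbackHopf h →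
        ∀ (c : OutputFeedback.Series m) (i : Fin m) (η : OutputFeedback.Word m),
          OutputFeedback.evalAt (OutputFeedback.DeltaSeries.mk c)⁻¹.toSeries
              (OutputFeedback.coord i η) =
            OutputFeedback.evalAt c
              (HopfAlgebra.antipode ℝ (OutputFeedback.coord i η)) := by
  have hu : ∀ h, OutputFeedback.IsOutputFeedbackHopf h → h = OutputFeedback.coordHopfAlgebra m :=
    fun h hh => OutputFeedback.isOutputFeedbackHopf_unique hh
      (OutputFeedback.isOutputFeedbackHopf_coordHopfAlgebra m)
  refine ⟨OutputFeedback.deltaGroup m, fun _ _ => rfl, rfl,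
    ⟨_, OutputFeedback.isOutputFeedbackHopf_coordHopfAlgebra m, hu⟩, ?_⟩
  intro h hh c i η
  obtain rfl := hu h hh
  -- The inverse of `deltaGroup` unfolds to `groupInv`, and the antipode of `coordHopfAlgebra` to
  -- `antipodeHom`.
  exact (OutputFeedback.evalAt_antipodeHom c (OutputFeedback.coord i η)).symm
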